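/- A \emph{sequential cascade} is a partially ordered set $(V,\sqsubset)$ with a least element $\varnothing_V$ such that every set $\{s\in V: s\sqsubset v\}$ is well ordered, every non-empty subset of $V$ has a maximal element, and for each non-maximal $v\in V$ the set $V^+(v)$ of immediate successors of $v$ is countably infinite. The \emph{rank} $r_V(v)$ is the least ordinal greater than the ranks of all successors of $v$ (so it is $0$ if $v\in\max V$). $V$ is \emph{monotone} if for each $v\in V\setminus\max V$ the set $V^+(v)$ admits an order of type $\omega$ for which $r_V$ is non-decreasing. All cascades below have their maximal elements in a fixed set $X$. The \emph{contour} $\int V=\int V(\varnothing_V)$ is the filter on $X$ defined inductively as follows: $\int V(v)$ is the principal filter of $v$ if $v\in\max V$, and otherwise $A\in\int V(v)$ if and only if $A\in\int V(w)$ for all but finitely many $w\in V^+(v)$. An \emph{eventual subcascade} of $V$ is a downward closed subset $U\ni\varnothing_V$ such that $U^+(v)=V^+(v)\cap U$ is cofinite in $V^+(v)$ for each $v\in U$. A sequential cascade $T$ is a \emph{locally finite partition} of $V$, in symbols $T\vartriangleright V$, if there exist an eventual subcascade $U$ of $V$ and a map $f:T\to V$ with finite fibers and with $U\subset f(T)$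 such that \begin{enumerate} \item $f^{-1}(\varnothing_V)=\{\varnothing_T\}$; \item $f(T^+(t))\subset V^+(f(t))$ for every $t\in T$, and $U^+(v)\subset f\left(\bigcup_{t\in f^{-1}(v)}T^+(t)\right)$ for every $v\in U\setminus\max V$; \item $\max T\subset\max V$ and $f$ is the identity on $\max T$. \end{enumerate} \textbf{Theorem.} If $V,W$ are monotone sequential cascades (with $\max V,\max W\subset X$) such that $\int V=\int W$, then there exists a monotone sequential cascade $T$ such that $T\vartriangleright V$ and $T\vartriangleright W$. -/

import Mathlib

universe u v w

/-- A sequential cascade whose maximal elements are (identified with) points of `X`: a tree with a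
least element, well-founded for the inverse order, in which every non-maximal element has countably
infinitely many immediate successors. The injection `leaf` realises the inclusion of the set of
maximal elements in `X`; two leaves, possibly of different cascades, are the same point exactly
when their images under `leaf` agree. -/
structure SequentialCascade (X : Type u) where
  Node : Type v
  [partialOrder : PartialOrder Node]
  [orderBot : OrderBot Node]
  /-- tree: the set of predecessors of every element is well ordered -/
  isWellOrder_Iio : ∀ x : Node, IsWellOrder (Set.Iio x) (· < ·)
  /-- well-founded for the inverse order -/
  wellFoundedGT : WellFoundedGT Node
  infinite_succ : ∀ x : Node, ¬ IsMax x → {y | x ⋖ y}.Infinite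
  countable_succ : ∀ x : Node, ¬ IsMax x → {y | x ⋖ y}.Countable
  leaf : {x : Node // IsMax x} ↪ X

namespace SequentialCascade

attribute [instance] partialOrder orderBot wellFoundedGT

variable {X : Type u}

/-- The set `V⁺(x)` of immediate successors of `x`. -/
def succs (V : SequentialCascade.{u, v} X) (x : V.Node) : Set V.Node := {y | x ⋖ y}

/-- The rank of `x`: the least ordinal greater than the ranks of all successors of `x`
(in particular `0` at maximal elements). -/
noncomputable def rank (V : SequentialCascade.{u, v} X) (x : V.Node) : Ordinal.{v} :=
  IsWellFounded.rank (· > ·) x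

/-- `V` is monotone: the immediate successors of each non-maximal element admit an order of
type `ω` for which the rank is non-decreasing. -/
def IsMonotone (V : SequentialCascade.{u, v} X) : Prop :=
  ∀ x : V.Node, ¬ IsMax x → ∃ e : ℕ ≃ V.succs x, Monotone fun n => V.rank (e n : V.Node)

open Classical in
/-- The contour `∫ V(x)` of the cascade of all elements above `x`, as a filter on `X`: the principal
filter of `x` if `x` is maximal, and otherwise the contour, along the cofinite filter of `V⁺(x)`, of
the filters `∫ V(y)`, `y ∈ V⁺(x)`. -/
noncomputable def contourAt (V : SequentialCascade.{u, v} X) : V.Node → Filter X :=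
  (wellFounded_gt (α := V.Node)).fix fun x ih =>
    if h : IsMax x then pure (V.leaf ⟨x, h⟩)
    else (Filter.cofinite : Filter (V.succs x)).bind fun y => ih y.1 y.2.lt

theorem contourAt_of_isMax (V : SequentialCascade.{u, v} X) (x : V.Node) (h : IsMax x) :
    V.contourAt x = pure (V.leaf ⟨x, h⟩) := by
  unfold contourAt
  rw [WellFounded.fix_eq, dif_pos h]

theorem mem_contourAt_of_not_isMax (V : SequentialCascade.{u, v} X) (x : V.Node) (h : ¬ IsMax x)
    (A : Set X) :
    A ∈ V.contourAt x ↔ {y : V.succs x | A ∉ V.contourAt y}.Finite := by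
  have e : V.contourAt x =
      (Filter.cofinite : Filter (V.succs x)).bind fun y => V.contourAt y := by
    unfold contourAt
    rw [WellFounded.fix_eq, dif_neg h]
  rw [e, Filter.mem_bind', Filter.mem_cofinite]
  rfl

/-- The sequential contour `∫ V`, as a filter on `X`. -/
noncomputable def contour (V : SequentialCascade.{u, v} X) : Filter X := V.contourAt ⊥

/-- `U` is (the underlying set of) an eventual subcascade of `V`: it has the same least element,
it is closed downwards, so that `U⁺(x) = V⁺(x) ∩ U`, and `U⁺(x)` is a cofinite subset of `V⁺(x)`
for each `x ∈ U`. -/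
def IsEventual (V : SequentialCascade.{u, v} X) (U : Set V.Node) : Prop :=
  ⊥ ∈ U ∧ IsLowerSet U ∧ ∀ x ∈ U, (V.succs x \ U).Finite

/-- `T` is a locally finite partition of `V`: there are an eventual subcascade `U` of `V` and a map
`f` from `T` to `V` with finite fibers whose range contains `U`, which sends only the least
element of `T` to the least element of `V`, sends immediate successors to immediate successors
(hence elements that are not maximal to elements that are not maximal),
sends the immediate successors of the elements of the fiber of `x` onto the immediate successors of
`x`, up to elements outside `U`, whenever `x ∈ U` is not maximal, and is the identity on
the set of maximal elements of `T` (in particular, these are maximal elements of `V`). -/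
def IsLocallyFinitePartition (T : SequentialCascade.{u, v} X) (V : SequentialCascade.{u, w} X) :
    Prop :=
  ∃ (U : Set V.Node) (f : T.Node → V.Node),
    V.IsEventual U ∧
    (∀ x, (f ⁻¹' {x}).Finite) ∧
    U ⊆ Set.range f ∧
    f ⁻¹' {⊥} = {⊥} ∧
    (∀ t, f '' T.succs t ⊆ V.succs (f t)) ∧
    (∀ x ∈ U, ¬ IsMax x → V.succs x ∩ U ⊆ f '' ⋃ t ∈ f ⁻¹' {x}, T.succs t) ∧
    ∀ (t : T.Node) (ht : IsMax t), ∃ hx : IsMax (f t), V.leaf ⟨f t, hx⟩ = T.leaf ⟨t, ht⟩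

end SequentialCascade

/-!
The common partition of `V` and `W` consists of pairs `(x, y)` of nodes of the same level, ordered
componentwise. It starts with the pair of least elements and is built so that, for each of its
pairs, the contours at `x` and at `y` mesh with the set of common leaves above `x` and `y` and
have the same trace on it (`Matched`). Given such a pair that is not maximal, one looks at the
traces `F i` of the contours at the successors `i` of `x`, which live on disjoint sets `P i` of
leaves, and at the traces `G j` of those at the successors `j` of `y`, which live on disjoint sets
`Q j`. A set meshes with infinitely many `F i` if and only if it meshes with infinitely many
`G j`. The point is that this forces agreement outside finitely many `i` and `j`
(`Filter.SameContour.exists_finite_agree`):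

* If `F i` and `G j` disagreed on a subset of `P i ∩ Q j` for a set of pairs not covered by
  finitely many rows and columns, there would be an infinite matching of such pairs, and the union
  of the corresponding sets would mesh with only one of the two contours.
* If infinitely many `F i` contained no finite union of the `Q j`, then each of these would mesh
  with some `E i` all of whose traces on the `Q j` are negligible, because subsets of `X` modulo a
  contour form a `σ`-closed algebra (`pseudoClosed_contourAt`). The union of suitable shrinkings
  of the `E i` meshes with the common contour, so infinitely many `G j` mesh with some
  `E i ∩ Q j`, and again an infinite matching gives a contradiction.

The successors of `(x, y)` are then the pairs of non-exceptional `i` and `j` for which `F i`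
meshes with `Q j`, and the matched nodes obtained in this way form a relation that is locally
finite on both sides and exhausts the traces of almost all successors (`exists_isMatching`). The
two projections of the cascade of pairs are the required maps; the image of each contains the
eventual subcascade of the nodes whose contour, together with those at all predecessors, is exhausted by
the related nodes. Finally, the successors of `(x, y)` project onto an infinite set of successors
of `x`, and in a monotone cascade any infinite set of successors determines the rank, so the pair
`(x, y)` has the rank of `x` (`rank_cascade`); since the projection is finite-to-one, monotonicity
passes to the pairs.
-/

open Filter Set

/-! ### Matchings and enumerations -/

/-- A relation between two types that is not covered by finitely many rows and columns contains an
infinite matching. -/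
theorem exists_injective_matching {I J : Type*} {r : I → J → Prop}
    (h : ∀ (N : Set I) (M : Set J), N.Finite → M.Finite → ∃ i ∉ N, ∃ j ∉ M, r i j) :
    ∃ (i : ℕ → I) (j : ℕ → J), i.Injective ∧ j.Injective ∧ ∀ k, r (i k) (j k) := by
  classical
  obtain ⟨f, hf, hf'⟩ := exists_seq_of_forall_finset_exists (α := I × J) (fun p => r p.1 p.2)
    (fun p q => p.1 ≠ q.1 ∧ p.2 ≠ q.2) (by
      intro s _
      obtain ⟨i, hi, j, hj, hr⟩ := h (Prod.fst '' (s : Set (I × J))) (Prod.snd '' (s : Set (I × J)))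
        (s.finite_toSet.image _) (s.finite_toSet.image _)
      exact ⟨(i, j), hr, fun x hx => ⟨fun e => hi ⟨x, hx, e⟩, fun e => hj ⟨x, hx, e⟩⟩⟩)
  refine ⟨fun k => (f k).1, fun k => (f k).2, ?_, ?_, hf⟩
  · intro m n hmn
    by_contra hne
    rcases lt_or_gt_of_ne hne with hl | hl
    · exact (hf' _ _ hl).1 hmn
    · exact (hf' _ _ hl).1 hmn.symm
  · intro m n hmn
    by_contra hne
    rcases lt_or_gt_of_ne hne with hl | hl
    · exact (hf' _ _ hl).2 hmn
    · exact (hf' _ _ hl).2 hmn.symm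

theorem exists_equiv_nat_monotone {S α : Type*} [Countable S] [Infinite S] [LinearOrder α]
    (r : S → α) (h : ∀ s, {t | r t < r s}.Finite) : ∃ e : ℕ ≃ S, Monotone fun n => r (e n) := by
  obtain ⟨enc, henc⟩ := exists_injective_nat S
  -- The rank of `s` in the lexicographic order by value, then by index.
  let lt : S → S → Prop := fun t s => r t < r s ∨ (r t = r s ∧ enc t < enc s)
  have hfin : ∀ s, {t | lt t s}.Finite := fun s =>
    ((h s).union ((finite_Iio (enc s)).preimage henc.injOn)).subset fun t ht =>
      ht.imp id fun ht => ht.2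
  let c : S → ℕ := fun s => {t | lt t s}.ncard
  have hc : ∀ t s, lt t s → c t < c s := by
    intro t s hts
    refine Set.ncard_lt_ncard ⟨fun a ha => ?_, fun hsub => ?_⟩ (hfin s)
    · rcases ha with ha | ha <;> rcases hts with hts | hts
      · exact Or.inl (ha.trans hts)
      · exact Or.inl (hts.1 ▸ ha)
      · exact Or.inl (ha.1 ▸ hts)
      · exact Or.inr ⟨ha.1.trans hts.1, ha.2.trans hts.2⟩
    · have := hsub hts
      simp [lt] at this
  have hinj : c.Injective := by
    intro s t hst
    by_contra hne
    rcases lt_trichotomy (r s) (r t) with hl | hl | hl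
    · exact (hc _ _ (Or.inl hl)).ne hst
    · rcases lt_or_gt_of_ne (henc.ne hne) with h' | h'
      · exact (hc _ _ (Or.inr ⟨hl, h'⟩)).ne hst
      · exact (hc _ _ (Or.inr ⟨hl.symm, h'⟩)).ne' hst
    · exact (hc _ _ (Or.inl hl)).ne' hst
  have : Infinite (range c) := infinite_coe_iff.2 (infinite_range_of_injective hinj)
  classical
  let o := Nat.Subtype.orderIsoOfNat (range c)
  refine ⟨o.toEquiv.trans (Equiv.ofInjective c hinj).symm, fun m n hmn => ?_⟩
  by_contra! hlt
  have h1 := hc _ _ (Or.inl hlt)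
  have h2 : ∀ k, c ((Equiv.ofInjective c hinj).symm (o k)) = o k := fun k =>
    congrArg Subtype.val ((Equiv.ofInjective c hinj).apply_symm_apply (o k))
  have h3 : (o m : ℕ) ≤ o n := o.monotone hmn
  simp only [Equiv.trans_apply] at h1
  exact absurd h1 (not_lt.2 (by simpa [h2] using h3))

/-! ### Sets meshing with a filter -/

/-- `F.Meets B`: the set `B` meshes with the filter `F`, that is, it meets every member of `F`. -/
def Filter.Meets {X : Type*} (F : Filter X) (B : Set X) : Prop := ∃ᶠ x in F, x ∈ B

namespace Filter

variable {X : Type*} {F : Filter X} {A B C : Set X}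

theorem Meets.mono (h : F.Meets A) (hAB : A ⊆ B) : F.Meets B :=
  Frequently.mono h fun _ hx => hAB hx

theorem not_meets_iff : ¬ F.Meets A ↔ Aᶜ ∈ F := by
  simp only [Meets, not_frequently]; rfl

theorem meets_iff : F.Meets A ↔ Aᶜ ∉ F := by
  rw [← not_meets_iff, not_not]

theorem not_meets_empty : ¬ F.Meets ∅ := by simp [not_meets_iff]

theorem meets_union : F.Meets (A ∪ B) ↔ F.Meets A ∨ F.Meets B :=
  frequently_or_distrib

theorem Meets.inter_mem (h : F.Meets A) (hB : B ∈ F) : F.Meets (A ∩ B) :=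
  Frequently.and_eventually h hB

theorem Meets.of_inter_mem (h : F.Meets A) (hB : B ∈ F) (hAC : A ∩ B ⊆ C) : F.Meets C :=
  (h.inter_mem hB).mono hAC

theorem meets_biUnion {ι : Type*} {I : Set ι} (hI : I.Finite) {s : ι → Set X} :
    F.Meets (⋃ i ∈ I, s i) ↔ ∃ i ∈ I, F.Meets (s i) := by
  simp only [Meets, mem_iUnion, exists_prop]
  exact frequently_exists_finite hI

theorem meets_inf_principal : (F ⊓ 𝓟 A).Meets B ↔ F.Meets (B ∩ A) := by
  simp only [Meets, frequently_inf_principal, mem_inter_iff, and_comm]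

/-- The `σ`-closedness of the algebra of subsets modulo `F`: every decreasing sequence of sets
meshing with `F` has a pseudo-intersection modulo `F` that meshes with `F`. -/
def PseudoClosed (F : Filter X) : Prop :=
  ∀ D : ℕ → Set X, Antitone D → (∀ n, F.Meets (D n)) →
    ∃ E, F.Meets E ∧ ∀ n, ¬ F.Meets (E \ D n)

theorem PseudoClosed.inf_principal (h : F.PseudoClosed) (A : Set X) :
    (F ⊓ 𝓟 A).PseudoClosed := by
  intro D hD hm
  obtain ⟨E, hE, hE'⟩ := h (fun n => D n ∩ A) (fun m n hmn => inter_subset_inter_left _ (hD hmn))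
    fun n => meets_inf_principal.1 (hm n)
  refine ⟨E, meets_inf_principal.2 ?_, fun n hn => hE' n ((meets_inf_principal.1 hn).mono ?_)⟩
  · rw [← sdiff_union_inter E A, meets_union] at hE
    rcases hE with hE | hE
    · exact absurd (hE.mono (sdiff_subset_sdiff_right inter_subset_right)) (hE' 0)
    · exact hE
  · rintro x ⟨⟨h1, h2⟩, -⟩
    exact ⟨h1, fun h => h2 h.1⟩

/-! ### Families of filters with the same contour -/

/-- Two families of filters, carried by disjoint sets `P i` and by disjoint sets `Q j`
respectively, whose contours along the cofinite filters coincide. -/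
structure SameContour {I J : Type*} (F : I → Filter X) (G : J → Filter X) (P : I → Set X)
    (Q : J → Set X) : Prop where
  mem_left : ∀ i, P i ∈ F i
  mem_right : ∀ j, Q j ∈ G j
  disjoint_left : Pairwise fun i i' => Disjoint (P i) (P i')
  disjoint_right : Pairwise fun j j' => Disjoint (Q j) (Q j')
  closed_left : ∀ i, (F i).PseudoClosed
  closed_right : ∀ j, (G j).PseudoClosed
  infinite_iff : ∀ B, {i | (F i).Meets B}.Infinite ↔ {j | (G j).Meets B}.Infinite

namespace SameContour

variable {I J : Type*} {F : I → Filter X} {G : J → Filter X} {P : I → Set X} {Q : J → Set X}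

theorem symm (h : SameContour F G P Q) : SameContour G F Q P :=
  ⟨h.mem_right, h.mem_left, h.disjoint_right, h.disjoint_left, h.closed_right, h.closed_left,
    fun B => (h.infinite_iff B).symm⟩

/-- The members of the first family that mesh with a union of pieces, one piece in each of the sets
`P (i k)`, are those that mesh with their own piece. -/
theorem infinite_iUnion_iff (h : SameContour F G P Q) {i : ℕ → I} (hi : i.Injective)
    {B : ℕ → Set X} (hB : ∀ k, B k ⊆ P (i k)) :
    {a | (F a).Meets (⋃ k, B k)}.Infinite ↔ {k | (F (i k)).Meets (B k)}.Infinite := by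
  have key : {a | (F a).Meets (⋃ k, B k)} = i '' {k | (F (i k)).Meets (B k)} := by
    ext a
    constructor
    · intro ha
      by_cases hk : ∃ k, i k = a
      · obtain ⟨k, rfl⟩ := hk
        refine ⟨k, Meets.of_inter_mem ha (h.mem_left _) ?_, rfl⟩
        rintro x ⟨hx, hxP⟩
        obtain ⟨l, hl⟩ := mem_iUnion.1 hx
        by_cases hkl : l = k
        · exact hkl ▸ hl
        · exact ((h.disjoint_left (hi.ne hkl)).le_bot ⟨hB l hl, hxP⟩).elim
      · refine (not_meets_empty (Meets.of_inter_mem ha (h.mem_left a) ?_)).elim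
        rintro x ⟨hx, hxP⟩
        obtain ⟨l, hl⟩ := mem_iUnion.1 hx
        exact (h.disjoint_left fun e => hk ⟨l, e⟩).le_bot ⟨hB l hl, hxP⟩
    · rintro ⟨k, hk, rfl⟩
      exact Meets.mono hk (subset_iUnion B k)
  rw [key, infinite_image_iff hi.injOn]

/-- Along an infinite matching between the two families, the pieces cut out by the matched pairs
mesh infinitely often on one side if and only if they do on the other. -/
theorem infinite_matching_iff (h : SameContour F G P Q) {i : ℕ → I} (hi : i.Injective)
    {j : ℕ → J} (hj : j.Injective) {B : ℕ → Set X} (hB : ∀ k, B k ⊆ P (i k) ∩ Q (j k)) :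
    {k | (F (i k)).Meets (B k)}.Infinite ↔ {k | (G (j k)).Meets (B k)}.Infinite := by
  rw [← h.infinite_iUnion_iff hi fun k => (hB k).trans inter_subset_left,
    ← h.symm.infinite_iUnion_iff hj fun k => (hB k).trans inter_subset_right]
  exact h.infinite_iff _

/-- Any set of pairs on which the two families disagree in a fixed direction is covered by
finitely many rows and columns. -/
theorem exists_finite_disagree (h : SameContour F G P Q) :
    ∃ (N : Set I) (M : Set J), N.Finite ∧ M.Finite ∧ ∀ i ∉ N, ∀ j ∉ M, ∀ B ⊆ P i ∩ Q j,
      (F i).Meets B → (G j).Meets B := by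
  by_contra! hcon
  obtain ⟨i, j, hi, hj, hr⟩ := exists_injective_matching
    (r := fun i j => ∃ B ⊆ P i ∩ Q j, (F i).Meets B ∧ ¬ (G j).Meets B) (by
      intro N M hN hM
      obtain ⟨i, hi, j, hj, B, hB⟩ := hcon N M hN hM
      exact ⟨i, hi, j, hj, B, hB⟩)
  choose B hB hF hG using hr
  have := (h.infinite_matching_iff hi hj hB).1 (by simpa [hF] using infinite_univ)
  simp [hG] at this

/-- Almost every filter of the first family contains a finite union of the carriers of the second
family. Otherwise each exceptional `F i` meshes with a set `E i` whose traces on all the `Q j` are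
negligible for `F i`; a union of shrunken copies of the sets `E i` meshes with the common contour,
and the filters `G j` that detect it contradict `infinite_matching_iff`. -/
theorem finite_setOf_not_covered [Countable I] [Countable J] (h : SameContour F G P Q) :
    {i | ∀ S : Set J, S.Finite → ⋃ j ∈ S, Q j ∉ F i}.Finite := by
  by_contra hbad
  obtain ⟨eI, heI⟩ := exists_injective_nat I
  obtain ⟨eJ, heJ⟩ := exists_injective_nat J
  set bad := {i | ∀ S : Set J, S.Finite → ⋃ j ∈ S, Q j ∉ F i} with hbad_def
  let S : ℕ → Set J := fun n => {j | eJ j < n}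
  have hS : ∀ n, (S n).Finite := fun n => (finite_Iio n).preimage heJ.injOn
  let D : ℕ → Set X := fun n => (⋃ j ∈ S n, Q j)ᶜ
  have hD : Antitone D := fun m n hmn => compl_subset_compl.2
    (biUnion_subset_biUnion_left fun j hj => lt_of_lt_of_le hj hmn)
  have hE : ∀ i ∈ bad, ∃ E, (F i).Meets E ∧ ∀ n, ¬ (F i).Meets (E \ D n) := by
    intro i hi
    refine h.closed_left i D hD fun n => ?_
    rw [meets_iff, compl_compl]
    exact hi _ (hS n)
  choose! E hE hED using hE
  have hEQ : ∀ i ∈ bad, ∀ j, ¬ (F i).Meets (E i ∩ Q j) := by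
    intro i hi j hm
    refine hED i hi (eJ j + 1) (hm.mono ?_)
    rintro x ⟨hx, hxQ⟩
    refine ⟨hx, fun hxD => hxD ?_⟩
    exact mem_biUnion (show j ∈ S (eJ j + 1) from Nat.lt_succ_self _) hxQ
  -- The bad indices `i` are matched with indices `j` such that `G j` meshes with `E i`.
  obtain ⟨i, j, hi, hj, hr⟩ := exists_injective_matching
    (r := fun i j => i ∈ bad ∧ (G j).Meets (E i ∩ P i ∩ Q j)) (by
      intro N M hN hM
      -- Shrinking `E i` to `D (eI i)` makes the union locally finite on each `Q j`.
      let C : Set X := ⋃ i ∈ bad \ N, E i ∩ D (eI i) ∩ P i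
      have hC : {i | (F i).Meets C}.Infinite := by
        refine (Set.Infinite.sdiff hbad hN).mono fun i hi => ?_
        have h1 := hE i hi.1
        rw [← sdiff_union_inter (E i) (D (eI i)), meets_union] at h1
        refine (h1.resolve_left (hED i hi.1 _)).of_inter_mem (h.mem_left i) ?_
        exact subset_biUnion_of_mem (u := fun i => E i ∩ D (eI i) ∩ P i) hi
      obtain ⟨j, hjC, hjM⟩ := (((h.infinite_iff C).1 hC).sdiff hM).nonempty
      have hfin : {i | eI i ≤ eJ j ∧ i ∈ bad \ N}.Finite :=
        ((finite_Iic (eJ j)).preimage heI.injOn).subset fun i hi => hi.1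
      have hm : (G j).Meets (⋃ i ∈ {i | eI i ≤ eJ j ∧ i ∈ bad \ N}, E i ∩ P i ∩ Q j) := by
        refine Meets.of_inter_mem hjC (h.mem_right j) ?_
        rintro x ⟨hx, hxQ⟩
        obtain ⟨i, hi, ⟨hxE, hxD⟩, hxP⟩ := mem_iUnion₂.1 hx
        refine mem_biUnion (x := i) ⟨?_, hi⟩ ⟨⟨hxE, hxP⟩, hxQ⟩
        by_contra! hlt
        exact hxD (mem_biUnion (show j ∈ S (eI i) from hlt) hxQ)
      obtain ⟨i, hi, him⟩ := (meets_biUnion hfin).1 hm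
      exact ⟨i, hi.2.2, j, hjM, hi.2.1, him⟩)
  have := (h.infinite_matching_iff hi hj (B := fun k => E (i k) ∩ P (i k) ∩ Q (j k))
    (fun k x hx => ⟨hx.1.2, hx.2⟩)).2 (by simpa [fun k => (hr k).2] using infinite_univ)
  obtain ⟨k, hk⟩ := this.nonempty
  exact hEQ _ (hr k).1 _ (Meets.mono hk fun x hx => ⟨hx.1.1, hx.2⟩)

/-- For `i` outside a finite set, the finite union of those carriers `Q j`, `j ∉ M`, that mesh with
`F i` belongs to `F i`: discarding finitely many `j` is harmless, since `⋃ j ∈ M, Q j` meshes with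
only finitely many of the filters `G j`, hence with only finitely many of the filters `F i`. -/
theorem finite_setOf_not_mem [Countable I] [Countable J] (h : SameContour F G P Q) {M : Set J}
    (hM : M.Finite) :
    {i | ⋃ j ∈ {j | j ∉ M ∧ (F i).Meets (Q j)}, Q j ∉ F i}.Finite := by
  have hMfin : {i | (F i).Meets (⋃ j ∈ M, Q j)}.Finite := by
    rw [← not_infinite, h.infinite_iff, not_infinite]
    refine hM.subset fun j hj => ?_
    by_contra hjM
    refine not_meets_empty (Meets.of_inter_mem hj (h.mem_right j) ?_)
    rintro x ⟨hx, hxQ⟩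
    obtain ⟨j', hj', hx'⟩ := mem_iUnion₂.1 hx
    exact (h.disjoint_right fun e : j' = j => hjM (e ▸ hj')).le_bot ⟨hx', hxQ⟩
  refine (h.finite_setOf_not_covered.union hMfin).subset fun i hi => ?_
  by_contra hcon
  simp only [mem_union, mem_ofPred_eq, not_or, not_forall, not_not] at hcon
  obtain ⟨⟨S, hS, hSF⟩, hMF⟩ := hcon
  refine hi ?_
  have h1 : ∀ j ∈ {j | j ∈ S ∧ ¬ (F i).Meets (Q j)}, (Q j)ᶜ ∈ F i := fun j hj =>
    not_meets_iff.1 hj.2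
  have h2 := (biInter_mem (hS.subset
    fun j (hj : j ∈ {j | j ∈ S ∧ ¬ (F i).Meets (Q j)}) => hj.1)).2 h1
  filter_upwards [hSF, not_meets_iff.1 hMF, h2] with x hxS hxM hx2
  obtain ⟨j, hj, hxj⟩ := mem_iUnion₂.1 hxS
  refine mem_biUnion (x := j) ⟨fun hjM => hxM (mem_biUnion hjM hxj), ?_⟩ hxj
  by_contra hjn
  exact mem_iInter₂.1 hx2 j ⟨hj, hjn⟩ hxj

/-- A finite union of carriers belonging to `F i` contains all carriers that mesh with `F i`. -/
theorem finite_meets_of_mem (h : SameContour F G P Q) {i : I} {S : Set J} (hS : S.Finite)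
    (hSF : ⋃ j ∈ S, Q j ∈ F i) : {j | (F i).Meets (Q j)}.Finite := by
  refine hS.subset fun j hj => ?_
  by_contra hjS
  refine not_meets_empty (Meets.of_inter_mem hj hSF ?_)
  rintro x ⟨hx, hx'⟩
  obtain ⟨j', hj', hxj'⟩ := mem_iUnion₂.1 hx'
  exact (h.disjoint_right fun e : j' = j => hjS (e ▸ hj')).le_bot ⟨hxj', hx⟩

/-- Two families with the same contour agree outside finitely many indices: up to these, the
relation `(F i).Meets (Q j)` is locally finite on both sides, and `F i` and `G j` have the same
trace on `P i ∩ Q j`. -/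
theorem exists_finite_agree [Countable I] [Countable J] (h : SameContour F G P Q) :
    ∃ (N : Set I) (M : Set J), N.Finite ∧ M.Finite ∧
      (∀ i ∉ N, ∀ j ∉ M, ∀ B, (F i).Meets (B ∩ Q j) ↔ (G j).Meets (B ∩ P i)) ∧
      (∀ i ∉ N, {j | (F i).Meets (Q j)}.Finite) ∧
      (∀ j ∉ M, {i | (G j).Meets (P i)}.Finite) := by
  obtain ⟨N₁, M₁, hN₁, hM₁, h₁⟩ := h.exists_finite_disagree
  obtain ⟨M₂, N₂, hM₂, hN₂, h₂⟩ := h.symm.exists_finite_disagree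
  refine ⟨N₁ ∪ N₂ ∪ {i | ∀ S : Set J, S.Finite → ⋃ j ∈ S, Q j ∉ F i},
    M₁ ∪ M₂ ∪ {j | ∀ S : Set I, S.Finite → ⋃ i ∈ S, P i ∉ G j},
    (hN₁.union hN₂).union h.finite_setOf_not_covered,
    (hM₁.union hM₂).union h.symm.finite_setOf_not_covered, ?_, ?_, ?_⟩
  · intro i hi j hj B
    simp only [mem_union, not_or] at hi hj
    constructor
    · intro hB
      exact (h₁ i hi.1.1 j hj.1.1 (B ∩ Q j ∩ P i) (fun x hx => ⟨hx.2, hx.1.2⟩)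
        (hB.inter_mem (h.mem_left i))).mono fun x hx => ⟨hx.1.1, hx.2⟩
    · intro hB
      exact (h₂ j hj.1.2 i hi.1.2 (B ∩ P i ∩ Q j) (fun x hx => ⟨hx.2, hx.1.2⟩)
        (hB.inter_mem (h.mem_right j))).mono fun x hx => ⟨hx.1.1, hx.2⟩
  · intro i hi
    simp only [mem_union, mem_ofPred_eq, not_or, not_forall, not_not] at hi
    obtain ⟨S, hS, hSF⟩ := hi.2
    exact h.finite_meets_of_mem hS hSF
  · intro j hj
    simp only [mem_union, mem_ofPred_eq, not_or, not_forall, not_not] at hj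
    obtain ⟨S, hS, hSF⟩ := hj.2
    exact h.symm.finite_meets_of_mem hS hSF

end SameContour

end Filter

/-! ### Levels of nodes -/

namespace SequentialCascade

variable {X : Type u} (V : SequentialCascade.{u, v} X)

theorem le_total_of_le {a b c : V.Node} (ha : a ≤ c) (hb : b ≤ c) : a ≤ b ∨ b ≤ a := by
  rcases ha.eq_or_lt with rfl | ha
  · exact Or.inr hb
  rcases hb.eq_or_lt with rfl | hb
  · exact Or.inl ha.le
  have := V.isWellOrder_Iio c
  rcases trichotomous_of (· < ·) (⟨a, ha⟩ : Iio c) ⟨b, hb⟩ with h | h | h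
  · exact Or.inl (Subtype.coe_lt_coe.2 h).le
  · exact Or.inl (congrArg Subtype.val h).le
  · exact Or.inr (Subtype.coe_lt_coe.2 h).le

/-- Every node has finitely many predecessors, since these are well ordered by both `<` and `>`. -/
theorem finite_Iio (x : V.Node) : (Iio x).Finite := by
  classical
  let _ : LinearOrder (Iio x) :=
    { (inferInstance : PartialOrder (Iio x)) with
      le_total := fun a b => V.le_total_of_le (le_of_lt a.2) (le_of_lt b.2)
      toDecidableLE := Classical.decRel _ }
  have : WellFoundedLT (Iio x) := ⟨(V.isWellOrder_Iio x).toIsWellFounded.wf⟩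
  have : Finite (Iio x) := Finite.of_wellFoundedLT_wellFoundedGT _
  exact toFinite _

/-- The level of a node: the number of its predecessors. -/
noncomputable def level (x : V.Node) : ℕ := (Iio x).ncard

theorem level_strictMono : StrictMono V.level := fun _ y hxy =>
  ncard_lt_ncard (Iio_ssubset_Iio hxy) (V.finite_Iio y)

theorem level_bot : V.level ⊥ = 0 := by simp [level]

theorem le_of_covBy_of_lt {a b c : V.Node} (hb : b ⋖ c) (ha : a < c) : a ≤ b := by
  rcases V.le_total_of_le ha.le hb.le with h | h
  · exact h
  · rcases h.eq_or_lt with h | h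
    · exact h.ge
    · exact (hb.2 h ha).elim

theorem eq_of_covBy {a b c : V.Node} (ha : a ⋖ c) (hb : b ⋖ c) : a = b :=
  (V.le_of_covBy_of_lt hb ha.lt).antisymm (V.le_of_covBy_of_lt ha hb.lt)

theorem level_of_covBy {x y : V.Node} (h : x ⋖ y) : V.level y = V.level x + 1 := by
  have : Iio y = insert x (Iio x) := by
    ext a
    constructor
    · intro ha
      exact (V.le_of_covBy_of_lt h ha).eq_or_lt
    · rintro (rfl | ha)
      · exact h.lt
      · exact lt_trans ha h.lt
  rw [level, this, ncard_insert_of_notMem (by simp) (V.finite_Iio x), level]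

instance : WellFoundedLT V.Node := V.level_strictMono.wellFoundedLT

theorem not_covBy_bot (x : V.Node) : ¬ x ⋖ ⊥ := fun h => not_lt_bot h.lt

/-! ### Leaves and contours -/

/-- The set of leaves above `x`, as a subset of `X`. -/
def leaves (x : V.Node) : Set X := {p | ∃ (u : V.Node) (hu : IsMax u), x ≤ u ∧ V.leaf ⟨u, hu⟩ = p}

theorem leaves_anti {x y : V.Node} (h : x ≤ y) : V.leaves y ⊆ V.leaves x := by
  rintro p ⟨u, hu, hyu, rfl⟩
  exact ⟨u, hu, h.trans hyu, rfl⟩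

theorem leaves_of_isMax {x : V.Node} (h : IsMax x) : V.leaves x = {V.leaf ⟨x, h⟩} := by
  ext p
  constructor
  · rintro ⟨u, hu, hxu, rfl⟩
    obtain rfl := h.eq_of_le hxu
    rfl
  · rintro rfl
    exact ⟨x, h, le_rfl, rfl⟩

theorem disjoint_leaves {x y z : V.Node} (hy : x ⋖ y) (hz : x ⋖ z) (hne : y ≠ z) :
    Disjoint (V.leaves y) (V.leaves z) := by
  rw [Set.disjoint_left]
  rintro p ⟨u, hu, hyu, rfl⟩ ⟨t, ht, hzt, h⟩
  obtain rfl : t = u := congrArg Subtype.val (V.leaf.injective h)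
  rcases V.le_total_of_le hyu hzt with h' | h'
  · exact (hz.2 hy.lt (h'.lt_of_ne hne))
  · exact (hy.2 hz.lt (h'.lt_of_ne hne.symm))

theorem meets_contourAt_of_isMax {x : V.Node} (h : IsMax x) {B : Set X} :
    (V.contourAt x).Meets B ↔ V.leaf ⟨x, h⟩ ∈ B := by
  rw [meets_iff, V.contourAt_of_isMax x h, mem_pure]
  simp

theorem meets_contourAt_of_not_isMax {x : V.Node} (h : ¬ IsMax x) {B : Set X} :
    (V.contourAt x).Meets B ↔ {y : V.succs x | (V.contourAt y).Meets B}.Infinite := by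
  rw [meets_iff, V.mem_contourAt_of_not_isMax x h]
  simp only [meets_iff]
  rfl

theorem infinite_coe_succs {x : V.Node} (h : ¬ IsMax x) : Infinite (V.succs x) :=
  (V.infinite_succ x h).to_subtype

theorem leaves_mem_contourAt (x : V.Node) : V.leaves x ∈ V.contourAt x := by
  induction x using WellFoundedGT.induction with
  | ind x ih =>
    by_cases h : IsMax x
    · rw [V.contourAt_of_isMax x h, V.leaves_of_isMax h]
      exact rfl
    · rw [V.mem_contourAt_of_not_isMax x h]
      refine finite_empty.subset fun y hy => hy ?_
      exact mem_of_superset (ih y y.2.lt) (V.leaves_anti y.2.le)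

theorem meets_inter_leaves {x : V.Node} {B : Set X} :
    (V.contourAt x).Meets (B ∩ V.leaves x) ↔ (V.contourAt x).Meets B :=
  ⟨fun h => h.mono inter_subset_left, fun h => h.inter_mem (V.leaves_mem_contourAt x)⟩

theorem meets_univ (x : V.Node) : (V.contourAt x).Meets univ := by
  induction x using WellFoundedGT.induction with
  | ind x ih =>
    by_cases h : IsMax x
    · exact (V.meets_contourAt_of_isMax h).2 trivial
    · rw [V.meets_contourAt_of_not_isMax h]
      have := V.infinite_coe_succs h
      refine infinite_univ.mono fun y _ => ih y y.2.lt

/-- Given sets `D n` meshing with the contour at `x`, the pseudo-intersection is assembled from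
traces of the `D n` on the leaves above distinct successors of `x`. -/
theorem pseudoClosed_contourAt (x : V.Node) : (V.contourAt x).PseudoClosed := by
  intro D hD hm
  by_cases h : IsMax x
  · refine ⟨univ, V.meets_univ x, fun n hn => ?_⟩
    exact ((V.meets_contourAt_of_isMax h).1 hn).2 ((V.meets_contourAt_of_isMax h).1 (hm n))
  · simp only [V.meets_contourAt_of_not_isMax h] at hm ⊢
    -- Choose distinct successors `y k`, one for each term of a subsequence of `D`.
    obtain ⟨n, y, hn, hy, hr⟩ := exists_injective_matching
      (r := fun (n : ℕ) (y : V.succs x) => (V.contourAt y).Meets (D n)) (by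
        intro N M hN hM
        obtain ⟨n, hnN⟩ := hN.infinite_compl.nonempty
        obtain ⟨y, hy, hyM⟩ := ((hm n).sdiff hM).nonempty
        exact ⟨n, hnN, y, hyM, hy⟩)
    refine ⟨⋃ k, D (n k) ∩ V.leaves (y k), ?_, fun m hinf => hinf ?_⟩
    · refine (infinite_range_of_injective hy).mono ?_
      rintro _ ⟨k, rfl⟩
      exact (V.meets_inter_leaves.2 (hr k)).mono
        (subset_iUnion (fun k => D (n k) ∩ V.leaves (y k)) k)
    · have hfin : {k | n k < m}.Finite := (Set.finite_Iio m).preimage hn.injOn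
      refine (hfin.image y).subset fun z hz => ?_
      by_contra hcon
      refine not_meets_empty ((V.meets_inter_leaves.2 hz).mono ?_)
      rintro p ⟨⟨hp, hpm⟩, hpz⟩
      obtain ⟨k, hk, hky⟩ := mem_iUnion.1 hp
      by_cases hzk : y k = z
      · refine hpm (hD ?_ hk)
        by_contra! hlt
        exact hcon ⟨k, hlt, hzk⟩
      · exact (V.disjoint_leaves (y k).2 z.2 fun e => hzk (Subtype.ext e)).le_bot ⟨hky, hpz⟩

/-! ### Rank and monotonicity -/

theorem rank_strictAnti : StrictAnti V.rank := fun _ _ h =>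
  IsWellFounded.rank_lt_of_rel (r := (· > ·)) h

theorem rank_le_iff {x : V.Node} {o : Ordinal.{v}} : V.rank x ≤ o ↔ ∀ y > x, V.rank y < o := by
  constructor
  · exact fun h y hy => (V.rank_strictAnti hy).trans_le h
  · intro h
    rw [rank, IsWellFounded.rank_eq]
    exact Ordinal.iSup_le fun y => Order.succ_le_of_lt (h y y.2)

variable {V}

theorem IsMonotone.finite_rank_lt (h : V.IsMonotone) {x : V.Node} (hx : ¬ IsMax x)
    (o : V.succs x) : {y : V.succs x | V.rank y < V.rank o}.Finite := by
  obtain ⟨e, he⟩ := h x hx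
  refine ((Set.finite_Iio (e.symm o)).image e).subset fun y hy => ⟨e.symm y, ?_, by simp⟩
  rw [Set.mem_Iio]
  by_contra! hle
  have := he hle
  simp only [Equiv.apply_symm_apply] at this
  exact absurd hy (not_lt.2 this)

theorem isMonotone_of_finite_rank_lt
    (h : ∀ (x : V.Node) (o : V.succs x), {y : V.succs x | V.rank y < V.rank o}.Finite) :
    V.IsMonotone := by
  intro x hx
  have := V.infinite_coe_succs hx
  have : Countable (V.succs x) := (V.countable_succ x hx).to_subtype
  exact exists_equiv_nat_monotone (fun y : V.succs x => V.rank y) (h x)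

/-! ### Matched nodes -/

variable {W : SequentialCascade.{u, w} X}

/-- `x` and `y` are matched if both contours mesh with the set of common leaves of the cascades
above `x` and `y`, and have the same trace on it. -/
def Matched (V : SequentialCascade.{u, v} X) (W : SequentialCascade.{u, w} X) (x : V.Node)
    (y : W.Node) : Prop :=
  (V.contourAt x).Meets (W.leaves y) ∧
    ∀ B, (V.contourAt x).Meets (B ∩ W.leaves y) ↔ (W.contourAt y).Meets (B ∩ V.leaves x)

theorem Matched.symm {x : V.Node} {y : W.Node} (h : V.Matched W x y) : W.Matched V y x := by
  refine ⟨?_, fun B => (h.2 B).symm⟩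
  have := (h.2 (V.leaves x)).1 (by rw [inter_comm, V.meets_inter_leaves]; exact h.1)
  exact this.mono inter_subset_left

theorem matched_of_contourAt_eq {x : V.Node} {y : W.Node} (h : V.contourAt x = W.contourAt y) :
    V.Matched W x y := by
  have h2 : ∀ B, (V.contourAt x).Meets (B ∩ W.leaves y) ↔ (V.contourAt x).Meets B := by
    intro B
    rw [h, W.meets_inter_leaves]
  refine ⟨?_, fun B => ?_⟩
  · rw [← univ_inter (W.leaves y), h2]
    exact V.meets_univ x
  · rw [h2, ← h, V.meets_inter_leaves]

/-- Contours at non-maximal nodes are free, so a leaf can only be matched with the same leaf. -/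
theorem Matched.isMax {x : V.Node} {y : W.Node} (h : V.Matched W x y) (hx : IsMax x) :
    ∃ hy : IsMax y, W.leaf ⟨y, hy⟩ = V.leaf ⟨x, hx⟩ := by
  have hm := h.symm.1
  rw [V.leaves_of_isMax hx] at hm
  by_cases hy : IsMax y
  · exact ⟨hy, (W.meets_contourAt_of_isMax hy).1 hm⟩
  · rw [W.meets_contourAt_of_not_isMax hy] at hm
    refine (hm ?_).elim
    refine Set.Subsingleton.finite fun a ha b hb => ?_
    by_contra hne
    obtain ⟨p, hp, hp'⟩ := (W.meets_inter_leaves.2 ha).exists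
    obtain ⟨q, hq, hq'⟩ := (W.meets_inter_leaves.2 hb).exists
    rw [mem_singleton_iff] at hp hq
    exact (W.disjoint_leaves a.2 b.2 fun e => hne (Subtype.ext e)).le_bot
      ⟨hp', (hp.trans hq.symm) ▸ hq'⟩

theorem Matched.isMax_iff {x : V.Node} {y : W.Node} (h : V.Matched W x y) : IsMax x ↔ IsMax y :=
  ⟨fun hx => (h.isMax hx).1, fun hy => (h.symm.isMax hy).1⟩

theorem Matched.infinite_iff {x : V.Node} {y : W.Node} (h : V.Matched W x y) (hx : ¬ IsMax x)
    (hy : ¬ IsMax y) (B : Set X) :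
    {x' : V.succs x | (V.contourAt x' ⊓ 𝓟 (W.leaves y)).Meets B}.Infinite ↔
      {y' : W.succs y | (W.contourAt y' ⊓ 𝓟 (V.leaves x)).Meets B}.Infinite := by
  simp only [meets_inf_principal]
  rw [← V.meets_contourAt_of_not_isMax hx, ← W.meets_contourAt_of_not_isMax hy, h.2]

/-- The traces of the contours at the successors of two matched nodes have the same contour. -/
theorem Matched.sameContour {x : V.Node} {y : W.Node} (h : V.Matched W x y) (hx : ¬ IsMax x) :
    SameContour (fun x' : V.succs x => V.contourAt x' ⊓ 𝓟 (W.leaves y))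
      (fun y' : W.succs y => W.contourAt y' ⊓ 𝓟 (V.leaves x))
      (fun x' => V.leaves x') (fun y' => W.leaves y') where
  mem_left x' := mem_inf_of_left (V.leaves_mem_contourAt x')
  mem_right y' := mem_inf_of_left (W.leaves_mem_contourAt y')
  disjoint_left a b hab := V.disjoint_leaves a.2 b.2 fun e => hab (Subtype.ext e)
  disjoint_right a b hab := W.disjoint_leaves a.2 b.2 fun e => hab (Subtype.ext e)
  closed_left x' := (V.pseudoClosed_contourAt x').inf_principal _
  closed_right y' := (W.pseudoClosed_contourAt y').inf_principal _
  infinite_iff := h.infinite_iff hx fun hy => hx (h.isMax_iff.2 hy)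

end SequentialCascade

/-! ### Matchings between cascades -/

namespace SequentialCascade

variable {X : Type u} {V : SequentialCascade.{u, v} X} {W : SequentialCascade.{u, w} X}

/-- A matching between two cascades with the same contour: a relation between nodes, built level
by level from the pair of least elements, that relates only matched nodes, is locally finite on
both sides, and for which the traces of almost all successors are exhausted by the successors
related to them. -/
structure IsMatching (V : SequentialCascade.{u, v} X) (W : SequentialCascade.{u, w} X)
    (R : V.Node → W.Node → Prop) : Prop where
  contour_eq : V.contour = W.contour
  bot : R ⊥ ⊥
  pred : ∀ {x' y'}, R x' y' → (x' = ⊥ ∧ y' = ⊥) ∨ ∃ x y, R x y ∧ x ⋖ x' ∧ y ⋖ y'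
  matched : ∀ {x y}, R x y → V.Matched W x y
  finite_right : ∀ {x y x'}, R x y → x ⋖ x' → {y' | y ⋖ y' ∧ R x' y'}.Finite
  finite_left : ∀ {x y y'}, R x y → y ⋖ y' → {x' | x ⋖ x' ∧ R x' y'}.Finite
  cover_right : ∀ {x y}, R x y → ¬ IsMax x →
    {x' : V.succs x | ⋃ y' ∈ {y' | y ⋖ y' ∧ R x' y'}, W.leaves y' ∉
      V.contourAt x' ⊓ 𝓟 (W.leaves y)}.Finite
  cover_left : ∀ {x y}, R x y → ¬ IsMax y →
    {y' : W.succs y | ⋃ x' ∈ {x' | x ⋖ x' ∧ R x' y'}, V.leaves x' ∉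
      W.contourAt y' ⊓ 𝓟 (V.leaves x)}.Finite

/-- The relation generated from the pair of least elements by passing from a related pair `x`, `y`
to pairs of immediate successors, outside the exceptional sets `N x y` and `M x y`, that share a set
of leaves meshing with the contour. -/
inductive MatchingRel (V : SequentialCascade.{u, v} X) (W : SequentialCascade.{u, w} X)
    (N : ∀ x : V.Node, W.Node → Set (V.succs x)) (M : V.Node → ∀ y : W.Node, Set (W.succs y)) :
    V.Node → W.Node → Prop
  | bot : MatchingRel V W N M ⊥ ⊥
  | step {x y x' y'} (hR : MatchingRel V W N M x y) (hx : x ⋖ x') (hy : y ⋖ y')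
      (hN : (⟨x', hx⟩ : V.succs x) ∉ N x y) (hM : (⟨y', hy⟩ : W.succs y) ∉ M x y)
      (hm : (V.contourAt x').Meets (W.leaves y')) : MatchingRel V W N M x' y'

theorem MatchingRel.inv {N : ∀ x : V.Node, W.Node → Set (V.succs x)}
    {M : V.Node → ∀ y : W.Node, Set (W.succs y)} {x x' : V.Node} {y y' : W.Node}
    (h : MatchingRel V W N M x' y') (hx : x ⋖ x') (hy : y ⋖ y') :
    (⟨x', hx⟩ : V.succs x) ∉ N x y ∧ (⟨y', hy⟩ : W.succs y) ∉ M x y ∧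
      (V.contourAt x').Meets (W.leaves y') := by
  cases h with
  | bot => exact (V.not_covBy_bot x hx).elim
  | step hR hx₀ hy₀ hN hM hm =>
    obtain rfl := V.eq_of_covBy hx hx₀
    obtain rfl := W.eq_of_covBy hy hy₀
    exact ⟨hN, hM, hm⟩

/-- Two cascades with the same contour admit a matching: the exceptional sets of successors are
those that `Filter.SameContour.exists_finite_agree` discards at each related pair. -/
theorem exists_isMatching (h : V.contour = W.contour) : ∃ R, V.IsMatching W R := by
  have key : ∀ (x : V.Node) (y : W.Node), ∃ (N : Set (V.succs x)) (M : Set (W.succs y)),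
      V.Matched W x y → ¬ IsMax x → N.Finite ∧ M.Finite ∧
        (∀ i ∉ N, ∀ j ∉ M, ∀ B, (V.contourAt i ⊓ 𝓟 (W.leaves y)).Meets (B ∩ W.leaves j) ↔
          (W.contourAt j ⊓ 𝓟 (V.leaves x)).Meets (B ∩ V.leaves i)) ∧
        (∀ i ∉ N, {j : W.succs y | (V.contourAt i ⊓ 𝓟 (W.leaves y)).Meets (W.leaves j)}.Finite) ∧
        (∀ j ∉ M, {i : V.succs x | (W.contourAt j ⊓ 𝓟 (V.leaves x)).Meets (V.leaves i)}.Finite) := by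
    intro x y
    by_cases hm : V.Matched W x y
    · by_cases hx : IsMax x
      · exact ⟨∅, ∅, fun _ h => (h hx).elim⟩
      · have : Countable (V.succs x) := (V.countable_succ x hx).to_subtype
        have : Countable (W.succs y) :=
          (W.countable_succ y fun hy => hx (hm.isMax_iff.2 hy)).to_subtype
        obtain ⟨N, M, hNM⟩ := (hm.sameContour hx).exists_finite_agree
        exact ⟨N, M, fun _ _ => hNM⟩
    · exact ⟨∅, ∅, fun h => (hm h).elim⟩
  choose N M hNM using key
  have meets_left : ∀ {x y} {x' : V.Node} {y' : W.Node} {B : Set X}, y ⋖ y' →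
      ((V.contourAt x' ⊓ 𝓟 (W.leaves y)).Meets (B ∩ W.leaves y') ↔
        (V.contourAt x').Meets (B ∩ W.leaves y')) ∧ (x ⋖ x' →
      ((W.contourAt y' ⊓ 𝓟 (V.leaves x)).Meets (B ∩ V.leaves x') ↔
        (W.contourAt y').Meets (B ∩ V.leaves x'))) := by
    intro x y x' y' B hy
    rw [meets_inf_principal, inter_assoc, inter_eq_self_of_subset_left (W.leaves_anti hy.le)]
    refine ⟨Iff.rfl, fun hx => ?_⟩
    rw [meets_inf_principal, inter_assoc, inter_eq_self_of_subset_left (V.leaves_anti hx.le)]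
  have matched : ∀ {x y}, MatchingRel V W N M x y → V.Matched W x y := by
    intro x y hR
    induction hR with
    | bot => exact matched_of_contourAt_eq h
    | @step x y x' y' hR hx hy hN hM hm ih =>
      refine ⟨hm, fun B => ?_⟩
      obtain ⟨-, -, ha, -⟩ := hNM x y ih hx.lt.not_isMax
      have := ha ⟨x', hx⟩ hN ⟨y', hy⟩ hM B
      rwa [(meets_left (x := x) hy).1, (meets_left hy).2 hx] at this
  refine ⟨MatchingRel V W N M, h, .bot, ?_, matched, ?_, ?_, ?_, ?_⟩
  · intro x' y' hR
    cases hR with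
    | bot => exact Or.inl ⟨rfl, rfl⟩
    | step hR hx hy hN hM hm => exact Or.inr ⟨_, _, hR, hx, hy⟩
  · intro x y x' hR hx
    obtain ⟨-, -, -, hb, -⟩ := hNM x y (matched hR) hx.lt.not_isMax
    by_cases hN : (⟨x', hx⟩ : V.succs x) ∈ N x y
    · exact finite_empty.subset fun y' hy' => ((hy'.2.inv hx hy'.1).1 hN).elim
    · refine ((hb _ hN).image Subtype.val).subset fun y' hy' => ⟨⟨y', hy'.1⟩, ?_, rfl⟩
      have := (hy'.2.inv hx hy'.1).2.2
      rw [← univ_inter (W.leaves y'), ← (meets_left (x := x) hy'.1).1, univ_inter] at this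
      exact this
  · intro x y y' hR hy
    have hmx := matched hR
    obtain ⟨-, -, -, -, hc⟩ := hNM x y hmx fun hx => hy.lt.not_isMax (hmx.isMax_iff.1 hx)
    by_cases hM : (⟨y', hy⟩ : W.succs y) ∈ M x y
    · exact finite_empty.subset fun x' hx' => ((hx'.2.inv hx'.1 hy).2.1 hM).elim
    · refine ((hc _ hM).image Subtype.val).subset fun x' hx' => ⟨⟨x', hx'.1⟩, ?_, rfl⟩
      have := (matched hx'.2).symm.1
      rw [← univ_inter (V.leaves x'), ← (meets_left hy).2 hx'.1, univ_inter] at this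
      exact this
  · intro x y hR hx
    have hmx := matched hR
    have : Countable (V.succs x) := (V.countable_succ x hx).to_subtype
    have : Countable (W.succs y) :=
      (W.countable_succ y fun hy => hx (hmx.isMax_iff.2 hy)).to_subtype
    obtain ⟨hN, hM, -⟩ := hNM x y hmx hx
    refine (hN.union ((hmx.sameContour hx).finite_setOf_not_mem hM)).subset fun x' hx' => ?_
    by_contra! hcon
    simp only [mem_union, not_or] at hcon
    refine hx' (mem_of_superset (not_not.1 hcon.2) ?_)
    refine iUnion₂_subset fun y' hy' => ?_
    refine subset_biUnion_of_mem (u := fun y' => W.leaves y') (x := (y' : W.Node)) ⟨y'.2, ?_⟩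
    refine hR.step x'.2 y'.2 hcon.1 hy'.1 ?_
    exact (meets_inf_principal.1 hy'.2).mono inter_subset_left
  · intro x y hR hy
    have hmx := matched hR
    have hx : ¬ IsMax x := fun hx => hy (hmx.isMax_iff.1 hx)
    have : Countable (V.succs x) := (V.countable_succ x hx).to_subtype
    have : Countable (W.succs y) := (W.countable_succ y hy).to_subtype
    obtain ⟨hN, hM, ha, -⟩ := hNM x y hmx hx
    refine (hM.union ((hmx.sameContour hx).symm.finite_setOf_not_mem hN)).subset fun y' hy' => ?_
    by_contra! hcon
    simp only [mem_union, not_or] at hcon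
    refine hy' (mem_of_superset (not_not.1 hcon.2) ?_)
    refine iUnion₂_subset fun x' hx' => ?_
    refine subset_biUnion_of_mem (u := fun x' => V.leaves x') (x := (x' : V.Node)) ⟨x'.2, ?_⟩
    refine hR.step x'.2 y'.2 hx'.1 hcon.1 ?_
    have h1 := (ha x' hx'.1 y' hcon.1 (V.leaves x')).2 (by rw [inter_self]; exact hx'.2)
    exact (meets_inf_principal.1 h1).mono (inter_subset_left.trans inter_subset_right)

namespace IsMatching

variable {R : V.Node → W.Node → Prop}

theorem swap (h : V.IsMatching W R) : W.IsMatching V fun y x => R x y where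
  contour_eq := h.contour_eq.symm
  bot := h.bot
  pred hR := by
    rcases h.pred hR with ⟨hx, hy⟩ | ⟨x, y, hR', hx, hy⟩
    · exact Or.inl ⟨hy, hx⟩
    · exact Or.inr ⟨y, x, hR', hy, hx⟩
  matched hR := (h.matched hR).symm
  finite_right hR hy := h.finite_left hR hy
  finite_left hR hx := h.finite_right hR hx
  cover_right hR hy := h.cover_left hR hy
  cover_left hR hx := h.cover_right hR hx

theorem level_eq (h : V.IsMatching W R) {x : V.Node} {y : W.Node} (hR : R x y) :
    V.level x = W.level y := by
  induction x using WellFoundedLT.induction generalizing y with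
  | ind x ih =>
    rcases h.pred hR with ⟨rfl, rfl⟩ | ⟨x₀, y₀, hR₀, hx, hy⟩
    · rw [level_bot, level_bot]
    · rw [V.level_of_covBy hx, W.level_of_covBy hy, ih x₀ hx.lt hR₀]

theorem eq_bot (h : V.IsMatching W R) {y : W.Node} (hR : R ⊥ y) : y = ⊥ := by
  rcases h.pred hR with ⟨-, rfl⟩ | ⟨x₀, y₀, -, hx, -⟩
  · rfl
  · exact (V.not_covBy_bot _ hx).elim

theorem exists_pred (h : V.IsMatching W R) {x x' : V.Node} {y' : W.Node} (hx : x ⋖ x')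
    (hR : R x' y') : ∃ y, R x y ∧ y ⋖ y' := by
  rcases h.pred hR with ⟨rfl, -⟩ | ⟨x₀, y₀, hR₀, hx₀, hy₀⟩
  · exact (V.not_covBy_bot _ hx).elim
  · obtain rfl := V.eq_of_covBy hx hx₀
    exact ⟨y₀, hR₀, hy₀⟩

theorem finite_fiber (h : V.IsMatching W R) (x : V.Node) : {y | R x y}.Finite := by
  induction x using WellFoundedLT.induction with
  | ind x ih =>
    by_cases hx : ∃ x₀, x₀ ⋖ x
    · obtain ⟨x₀, hx₀⟩ := hx
      refine ((ih x₀ hx₀.lt).biUnion fun y₀ hy₀ => h.finite_right hy₀ hx₀).subset fun y hy => ?_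
      obtain ⟨y₀, hR₀, hy₀⟩ := h.exists_pred hx₀ hy
      exact mem_biUnion (x := y₀) hR₀ ⟨hy₀, hy⟩
    · refine (finite_singleton ⊥).subset fun y hy => ?_
      rcases h.pred hy with ⟨-, rfl⟩ | ⟨x₀, y₀, -, hx₀, -⟩
      · rfl
      · exact (hx ⟨x₀, hx₀⟩).elim

/-- Infinitely many successors of `x` are related to successors of `y`: infinitely many of their
contours mesh with the leaves of `y`, and almost all of these are covered. -/
theorem infinite_succs (h : V.IsMatching W R) {x : V.Node} {y : W.Node} (hR : R x y)
    (hx : ¬ IsMax x) : {x' : V.succs x | ∃ y', y ⋖ y' ∧ R x' y'}.Infinite := by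
  have hm := (h.matched hR).1
  rw [V.meets_contourAt_of_not_isMax hx] at hm
  refine (hm.sdiff (h.cover_right hR hx)).mono fun x' hx' => ?_
  obtain ⟨hx1, hx2⟩ := hx'
  have hx3 : (V.contourAt x' ⊓ 𝓟 (W.leaves y)).Meets univ :=
    meets_inf_principal.2 (by rwa [univ_inter])
  obtain ⟨p, -, hp⟩ := (hx3.inter_mem (not_not.1 hx2)).exists
  obtain ⟨y', hy', -⟩ := mem_iUnion₂.1 hp
  exact ⟨y', hy'⟩

/-- `x` is covered if the leaves of the nodes related to it exhaust its contour. -/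
def Covered (_ : V.IsMatching W R) (x : V.Node) : Prop :=
  ⋃ y ∈ {y | R x y}, W.leaves y ∈ V.contourAt x

theorem exists_of_covered (h : V.IsMatching W R) {x : V.Node} (hx : h.Covered x) : ∃ y, R x y := by
  obtain ⟨p, -, hp⟩ := ((V.meets_univ x).inter_mem hx).exists
  obtain ⟨y, hy, -⟩ := mem_iUnion₂.1 hp
  exact ⟨y, hy⟩

/-- Almost all successors of a covered node are covered. -/
theorem finite_not_covered (h : V.IsMatching W R) {x : V.Node} (hx : h.Covered x)
    (hmax : ¬ IsMax x) : {x' : V.succs x | ¬ h.Covered x'}.Finite := by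
  have h1 := (V.mem_contourAt_of_not_isMax x hmax _).1 hx
  have h2 := (h.finite_fiber x).biUnion fun y hy => h.cover_right hy hmax
  refine (h1.union h2).subset fun x' hx' => ?_
  by_contra hcon
  simp only [mem_union, not_or, mem_ofPred_eq, not_not, mem_iUnion, not_exists] at hcon
  have h3 := (biInter_mem (h.finite_fiber x)).2 fun y hy =>
    mem_inf_principal.1 (hcon.2 y hy)
  refine hx' (mem_of_superset (inter_mem hcon.1 h3) ?_)
  rintro p ⟨hp, hp3⟩
  obtain ⟨y, hy, hpy⟩ := mem_iUnion₂.1 hp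
  obtain ⟨y', hy', hpy'⟩ := mem_iUnion₂.1 (mem_iInter₂.1 hp3 y hy hpy)
  exact mem_biUnion (x := y') hy'.2 hpy'

/-- The nodes all of whose predecessors are covered form an eventual subcascade. -/
theorem isEventual (h : V.IsMatching W R) : V.IsEventual {x | ∀ z ≤ x, h.Covered z} := by
  refine ⟨fun z hz => ?_, fun a b hba ha z hz => ha z (hz.trans hba), fun x hx => ?_⟩
  · obtain rfl := le_bot_iff.1 hz
    have h1 : W.leaves ⊥ ∈ V.contour := h.contour_eq ▸ W.leaves_mem_contourAt ⊥
    exact mem_of_superset h1 (subset_biUnion_of_mem (u := fun y => W.leaves y) h.bot)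
  · by_cases hmax : IsMax x
    · exact finite_empty.subset fun x' hx' => hmax.not_lt hx'.1.lt
    · refine ((h.finite_not_covered (hx x le_rfl) hmax).image Subtype.val).subset fun x' hx' => ?_
      refine ⟨⟨x', hx'.1⟩, fun hc => hx'.2 fun z hz => ?_, rfl⟩
      rcases hz.eq_or_lt with rfl | hz
      · exact hc
      · exact hx z (V.le_of_covBy_of_lt hx'.1 hz)

/-- A cascade whose nodes correspond to the pairs related by a matching is a locally finite
partition of the first cascade. -/
theorem isLocallyFinitePartition (h : V.IsMatching W R) {T : SequentialCascade.{u, v} X}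
    {f : T.Node → V.Node} {g : T.Node → W.Node} (hR : ∀ t, R (f t) (g t))
    (hex : ∀ {x y}, R x y → ∃ t, f t = x ∧ g t = y)
    (hinj : ∀ {t t'}, f t = f t' → g t = g t' → t = t')
    (hcov : ∀ {t t'}, t ⋖ t' ↔ f t ⋖ f t' ∧ g t ⋖ g t') (hf : f ⊥ = ⊥) (hg : g ⊥ = ⊥)
    (hleaf : ∀ (t : T.Node) (ht : IsMax t),
      ∃ hx : IsMax (f t), V.leaf ⟨f t, hx⟩ = T.leaf ⟨t, ht⟩) :
    T.IsLocallyFinitePartition V := by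
  refine ⟨{x | ∀ z ≤ x, h.Covered z}, f, h.isEventual, fun x => ?_, fun x hx => ?_, ?_, ?_, ?_,
    hleaf⟩
  · refine Finite.of_finite_image (f := g) ((h.finite_fiber x).subset ?_) ?_
    · rintro _ ⟨t, rfl, rfl⟩
      exact hR t
    · intro t ht t' ht' hgt
      exact hinj (Eq.trans ht (Eq.symm ht')) hgt
  · obtain ⟨y, hy⟩ := h.exists_of_covered (hx x le_rfl)
    obtain ⟨t, ht, -⟩ := hex hy
    exact ⟨t, ht⟩
  · ext t
    constructor
    · intro ht
      have ht : f t = ⊥ := ht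
      exact hinj (ht.trans hf.symm) ((h.eq_bot (ht ▸ hR t)).trans hg.symm)
    · rintro rfl
      exact hf
  · rintro t _ ⟨t', ht', rfl⟩
    exact (hcov.1 ht').1
  · rintro x - - x' ⟨hx', hU⟩
    obtain ⟨y', hy'⟩ := h.exists_of_covered (hU x' le_rfl)
    obtain ⟨y, hy, hyy'⟩ := h.exists_pred hx' hy'
    obtain ⟨t, rfl, rfl⟩ := hex hy
    obtain ⟨t', rfl, rfl⟩ := hex hy'
    exact ⟨t', mem_biUnion (x := t) rfl (hcov.2 ⟨hx', hyy'⟩), rfl⟩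

/-! ### The cascade of related pairs -/

section

variable {V : SequentialCascade.{u, v} X} {W : SequentialCascade.{u, v} X}
  {R : V.Node → W.Node → Prop}

/-- For related pairs whose second components lie below a common node, the order is decided by the
first components, because related nodes have the same level. -/
theorem le_snd_of_le_fst (h : V.IsMatching W R) {x x' : V.Node} {y y' z : W.Node} (hR : R x y)
    (hR' : R x' y') (hx : x ≤ x') (hy : y ≤ z) (hy' : y' ≤ z) : y ≤ y' := by
  rcases W.le_total_of_le hy hy' with hl | hl
  · exact hl
  · rcases hl.eq_or_lt with hl | hl
    · exact hl.ge
    · have h1 := W.level_strictMono hl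
      have h2 := V.level_strictMono.monotone hx
      rw [h.level_eq hR, h.level_eq hR'] at h2
      omega

theorem lt_of_lt (h : V.IsMatching W R) {x x' : V.Node} {y y' : W.Node} (hR : R x y)
    (hR' : R x' y') (hlt : (x, y) < (x', y')) : x < x' ∧ y < y' := by
  have hx : x ≤ x' := hlt.le.1
  have hy : y ≤ y' := hlt.le.2
  have h1 := h.level_eq hR
  have h2 := h.level_eq hR'
  rcases hx.eq_or_lt with rfl | hx <;> rcases hy.eq_or_lt with rfl | hy
  · exact (lt_irrefl _ hlt).elim
  · have := W.level_strictMono hy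
    omega
  · have := V.level_strictMono hx
    omega
  · exact ⟨hx, hy⟩

/-- The pairs related by a matching, with the componentwise order. -/
abbrev Pairs (_ : V.IsMatching W R) : Type v := {p : V.Node × W.Node // R p.1 p.2}

theorem covBy_iff (h : V.IsMatching W R) {t t' : h.Pairs} :
    t ⋖ t' ↔ t.1.1 ⋖ t'.1.1 ∧ t.1.2 ⋖ t'.1.2 := by
  constructor
  · intro ht
    obtain ⟨hx, hy⟩ := h.lt_of_lt t.2 t'.2 ht.lt
    rcases h.pred t'.2 with ⟨hb, -⟩ | ⟨x₀, y₀, hR₀, hx₀, hy₀⟩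
    · exact (not_lt_bot (hb ▸ hx)).elim
    · have hle : t ≤ ⟨(x₀, y₀), hR₀⟩ :=
        ⟨V.le_of_covBy_of_lt hx₀ hx, W.le_of_covBy_of_lt hy₀ hy⟩
      have hlt : (⟨(x₀, y₀), hR₀⟩ : h.Pairs) < t' :=
        Prod.mk_lt_mk.2 (Or.inl ⟨hx₀.lt, hy₀.le⟩)
      rcases hle.eq_or_lt with rfl | hle
      · exact ⟨hx₀, hy₀⟩
      · exact (ht.2 hle hlt).elim
  · rintro ⟨hx, hy⟩
    refine ⟨Prod.lt_iff.2 (Or.inl ⟨hx.lt, hy.le⟩), fun s hs hs' => ?_⟩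
    exact hx.2 (h.lt_of_lt t.2 s.2 hs).1 (h.lt_of_lt s.2 t'.2 hs').1

theorem infinite_covBy (h : V.IsMatching W R) (t : h.Pairs) (hx : ¬ IsMax t.1.1) :
    {t' | t ⋖ t'}.Infinite := by
  refine Infinite.of_image (fun t' : h.Pairs => t'.1.1)
    (((h.infinite_succs t.2 hx).image Subtype.val_injective.injOn).mono ?_)
  rintro _ ⟨x', ⟨y', hy', hR'⟩, rfl⟩
  exact ⟨⟨(x', y'), hR'⟩, h.covBy_iff.2 ⟨x'.2, hy'⟩, rfl⟩

theorem isMax_iff (h : V.IsMatching W R) {t : h.Pairs} : IsMax t ↔ IsMax t.1.1 := by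
  constructor
  · intro ht
    by_contra hx
    obtain ⟨t', ht'⟩ := (h.infinite_covBy t hx).nonempty
    exact ht.not_lt ht'.lt
  · intro hx
    refine isMax_iff_forall_not_lt.2 fun t' ht' => ?_
    exact hx.not_lt (h.lt_of_lt t.2 t'.2 ht').1

/-- The cascade of the pairs related by a matching, with the componentwise order. By
`Matched.isMax`, a maximal pair consists of two copies of one leaf. -/
noncomputable def cascade (h : V.IsMatching W R) : SequentialCascade.{u, v} X where
  Node := h.Pairs
  orderBot := { bot := ⟨⊥, h.bot⟩, bot_le := fun t => (bot_le : ⊥ ≤ t.1) }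
  isWellOrder_Iio t :=
    { wf := by
        refine Subrelation.wf (r := InvImage (· < ·) fun s : Iio t => s.1.1.1) ?_
          (InvImage.wf _ wellFounded_lt)
        intro a b hab
        exact (h.lt_of_lt a.1.2 b.1.2 hab).1
      trichotomous := by
        intro a b hab hba
        have ha : a.1.1 ≤ t.1 := le_of_lt a.2
        have hb : b.1.1 ≤ t.1 := le_of_lt b.2
        rcases V.le_total_of_le ha.1 hb.1 with hl | hl
        · have hle : a ≤ b := ⟨hl, h.le_snd_of_le_fst a.1.2 b.1.2 hl ha.2 hb.2⟩
          exact hle.eq_or_lt.resolve_right hab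
        · have hle : b ≤ a := ⟨hl, h.le_snd_of_le_fst b.1.2 a.1.2 hl hb.2 ha.2⟩
          exact (hle.eq_or_lt.resolve_right hba).symm }
  wellFoundedGT := ⟨by
    refine Subrelation.wf (r := InvImage (· > ·) fun s : h.Pairs => s.1.1) ?_
      (InvImage.wf _ wellFounded_gt)
    intro a b hab
    exact (h.lt_of_lt b.2 a.2 hab).1⟩
  infinite_succ t ht := h.infinite_covBy t (h.isMax_iff.not.1 ht)
  countable_succ t ht := by
    have hx := h.isMax_iff.not.1 ht
    have hy := (h.matched t.2).isMax_iff.not.1 hx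
    refine ((V.countable_succ _ hx).prod (W.countable_succ _ hy)).preimage_of_injOn
      (f := Subtype.val) Subtype.val_injective.injOn |>.mono fun t' ht' => ?_
    exact h.covBy_iff.1 ht'
  leaf := ⟨fun t => V.leaf ⟨t.1.1.1, h.isMax_iff.1 t.2⟩, by
    intro t t' htt'
    have hx : t.1.1.1 = t'.1.1.1 := congrArg Subtype.val (V.leaf.injective htt')
    obtain ⟨h1, h2⟩ := (h.matched t.1.2).isMax (h.isMax_iff.1 t.2)
    obtain ⟨h1', h2'⟩ := (h.matched t'.1.2).isMax (h.isMax_iff.1 t'.2)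
    have hy : t.1.1.2 = t'.1.1.2 :=
      congrArg Subtype.val (W.leaf.injective (h2.trans (htt'.trans h2'.symm)))
    exact Subtype.ext (Subtype.ext (Prod.ext hx hy))⟩

/-- Over a monotone cascade, pairs have the rank of their first component: ranks of successors are
non-decreasing, so any infinite set of successors determines the rank. -/
theorem rank_cascade (h : V.IsMatching W R) (hV : V.IsMonotone) (t : h.cascade.Node) :
    h.cascade.rank t = V.rank t.1.1 := by
  induction t using WellFoundedGT.induction with
  | ind t ih =>
    apply le_antisymm
    · rw [rank_le_iff]
      intro t' ht'
      rw [ih t' ht']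
      exact V.rank_strictAnti (h.lt_of_lt t.2 t'.2 ht').1
    · rw [rank_le_iff]
      intro x' hx'
      obtain ⟨z, hz, hzx⟩ := LT.lt.exists_covby_le hx'
      have hx : ¬ IsMax t.1.1 := hx'.not_isMax
      obtain ⟨z', ⟨y', hy', hR'⟩, hz'⟩ :=
        ((h.infinite_succs t.2 hx).sdiff (hV.finite_rank_lt hx ⟨z, hz⟩)).nonempty
      let t' : h.cascade.Node := ⟨(z', y'), hR'⟩
      have ht' : t < t' := (h.covBy_iff.2 ⟨z'.2, hy'⟩ : (show h.Pairs from t) ⋖ t').lt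
      calc V.rank x' ≤ V.rank z := V.rank_strictAnti.antitone hzx
        _ ≤ V.rank z' := not_lt.1 hz'
        _ = h.cascade.rank t' := (ih t' ht').symm
        _ < h.cascade.rank t := h.cascade.rank_strictAnti ht'

theorem isMonotone_cascade (h : V.IsMatching W R) (hV : V.IsMonotone) : h.cascade.IsMonotone := by
  refine isMonotone_of_finite_rank_lt fun t o => ?_
  have ho := (h.covBy_iff.1 o.2).1
  simp only [h.rank_cascade hV]
  refine Finite.of_finite_image (f := fun s : h.cascade.succs t => s.1.1) (Finite.subset
    ((hV.finite_rank_lt ho.lt.not_isMax ⟨_, ho⟩).biUnion fun x' _ =>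
      (h.finite_fiber x').image (Prod.mk (x' : V.Node))) ?_) ?_
  · rintro _ ⟨s, hs, rfl⟩
    exact mem_biUnion (x := (⟨_, (h.covBy_iff.1 s.2).1⟩ : V.succs _)) hs ⟨_, s.1.2, rfl⟩
  · exact fun a _ b _ hab => Subtype.ext (Subtype.ext hab)

end

end IsMatching

end SequentialCascade

theorem mainTheorem7 {X : Type u} (V W : SequentialCascade.{u, v} X)
    (hV : V.IsMonotone) (hW : W.IsMonotone) (h : V.contour = W.contour) :
    ∃ T : SequentialCascade.{u, v} X,
      T.IsMonotone ∧ T.IsLocallyFinitePartition V ∧ T.IsLocallyFinitePartition W := by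
  obtain ⟨R, hR⟩ := SequentialCascade.exists_isMatching h
  refine ⟨hR.cascade, hR.isMonotone_cascade hV, ?_, ?_⟩
  · exact hR.isLocallyFinitePartition (f := fun t => t.1.1) (g := fun t => t.1.2) (fun t => t.2)
      (fun {x y} hxy => ⟨⟨(x, y), hxy⟩, rfl, rfl⟩) (fun hf hg => Subtype.ext (Prod.ext hf hg))
      hR.covBy_iff rfl rfl fun t ht => ⟨hR.isMax_iff.1 ht, rfl⟩
  · exact hR.swap.isLocallyFinitePartition (f := fun t => t.1.2) (g := fun t => t.1.1)
      (fun t => t.2) (fun {y x} hxy => ⟨⟨(x, y), hxy⟩, rfl, rfl⟩)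
      (fun hf hg => Subtype.ext (Prod.ext hg hf))
      (hR.covBy_iff.trans and_comm) rfl rfl fun t ht => (hR.matched t.2).isMax (hR.isMax_iff.1 ht)
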